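/- A $3$-player game $\mathcal G$ with binary questions and answers consists of a probability distribution $Q$ on $\{0,1\}^3$ and a predicate $V:\{0,1\}^3\times\{0,1\}^3\to\{0,1\}$. Its value is $$\mathrm{val}(\mathcal G)=\max_{f,g,h:\{0,1\}\to\{0,1\}}\ \Pr_{(x,y,z)\sim Q}\bigl[V\bigl((x,y,z),(f(x),g(y),h(z))\bigr)=1\bigr].$$ In the $n$-fold parallel repetition $\mathcal G^{\otimes n}$, question triples $(x_i,y_i,z_i)$, $i=1,\dots,n$, are drawn independently from $Q$; the three players receive $x=(x_1,\dots,x_n)$, $y=(y_1,\dots,y_n)$ and $z=(z_1,\dots,z_n)$ respectively, and each replies with a string in $\{0,1\}^n$ depending only on the string received, say $a$, $b$ and $c$; they win if $V\bigl((x_i,y_i,z_i),(a_i,b_i,c_i)\bigr)=1$ for every $i$. The value $\mathrm{val}(\mathcal G^{\otimes n})$ is the maximal winning probability over all such strategies. **Theorem.** Let $\mathcal G$ be a $3$-player game with binary questions and answers whose question distribution $Q$ is uniform on $\{(1,0,0),(0,1,0),(0,0,1)\}$, and suppose that $\mathrm{val}(\mathcal G)<1$. Then there is a constant $\kappa=\kappa(\mathcal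 G)>0$ such that $\mathrm{val}(\mathcal G^{\otimes n})\le 2^{-\kappa n}$ for every integer $n\ge 1$. -/

import Mathlib

/-- A `k`-player game. Player `j` receives a question in the finite set `X j` and answers in the
finite set `A j`; the questions are drawn jointly from the probability distribution `Q`, and
`V x a` says whether the answers `a` to the questions `x` are accepted. -/
structure MultiplayerGame (k : ℕ) (X A : Fin k → Type) [∀ j, Fintype (X j)] where
  Q : (∀ j, X j) → ℝ
  Q_nonneg : ∀ x, 0 ≤ Q x
  Q_sum : ∑ x, Q x = 1
  V : (∀ j, X j) → (∀ j, A j) → Bool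

namespace MultiplayerGame

variable {k : ℕ} {X A : Fin k → Type} [∀ j, Fintype (X j)]

/-- The probability, over questions `x` drawn from `Q`, that the deterministic strategies
`f j : X j → A j` of the players win the game. -/
noncomputable def winProb (G : MultiplayerGame k X A) (f : ∀ j, X j → A j) : ℝ :=
  ∑ x, if G.V x (fun j => f j (x j)) = true then G.Q x else 0

/-- The value of a game: the maximal winning probability over all strategies of the players. -/
noncomputable def val (G : MultiplayerGame k X A) : ℝ :=
  ⨆ f : (∀ j, X j → A j), G.winProb f

/-- The value is indeed a maximum. -/
theorem isGreatest_val [∀ j, Finite (A j)] [∀ j, Nonempty (A j)] (G : MultiplayerGame k X A) :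
    IsGreatest (Set.range G.winProb) G.val :=
  ⟨(Set.range_nonempty _).csSup_mem (Set.finite_range _),
    fun _ h => le_csSup (Set.finite_range _).bddAbove h⟩

/-- The weights of the `n`-fold product of the question distribution sum to one. -/
theorem sum_prod_Q (G : MultiplayerGame k X A) (n : ℕ) :
    ∑ x : (∀ j, Fin n → X j), ∏ i, G.Q (fun j => x j i) = 1 := by
  have h : ∑ x : (∀ j, Fin n → X j), ∏ i, G.Q (fun j => x j i)
      = ∑ y : (Fin n → ∀ j, X j), ∏ i, G.Q (y i) :=
    Fintype.sum_equiv (Equiv.piComm fun (j : Fin k) (_ : Fin n) => X j) _ _ (fun _ => rfl)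
  rw [h, ← Fintype.sum_pow, G.Q_sum, one_pow]

/-- The `n`-fold parallel repetition: the `n` question tuples are drawn independently from `Q`,
player `j` receives all of its `n` questions `x j` at once and returns `n` answers, and the players
win if they win in every coordinate. -/
def repetition (G : MultiplayerGame k X A) (n : ℕ) :
    MultiplayerGame k (fun j => Fin n → X j) (fun j => Fin n → A j) where
  Q x := ∏ i, G.Q (fun j => x j i)
  Q_nonneg _ := Finset.prod_nonneg fun _ _ => G.Q_nonneg _
  Q_sum := G.sum_prod_Q n
  V x a := decide (∀ i, G.V (fun j => x j i) (fun j => a j i) = true)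

open Classical in
/-- The questions of the game are distributed uniformly over the set `S`. -/
def IsUniformOn (G : MultiplayerGame k X A) (S : Finset (∀ j, X j)) : Prop :=
  ∀ x, G.Q x = if x ∈ S then (S.card : ℝ)⁻¹ else 0

end MultiplayerGame

/-! Encode a question tuple by `ω i`, the player asked `1` in coordinate `i`; for a fixed strategy
it suffices to show that the set `W` of winning `ω` has at most `(3c)^n` elements with `c < 1`. The
answer of the player asked `1` is only constrained existentially, so what matters are three
relations `R j` on the answers of the two players asked `0`. If `val < 1`, no assignment of answers
to question `0` satisfies all three. A finite check (`isDegenerate_or_anticorrelated`) leaves two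
situations.

Degenerate relations: some player must give a fixed answer whenever a certain other player is asked
`1`. Deviating from it in a coordinate excludes one of two possible values of `ω i`, hence halves
the available mass, so deviations are exponentially rare on `W`. Yet the relations make a deviation
occur whenever a guess of `ω i`, made by a player asked `0`, is right, and such a guess cannot be
wrong almost always (`card_le_of_forced_answers`).

Anti-correlation: two players asked `0` must answer differently. Resample `ω` three times, each time
keeping one player's view, and suppose all four tuples lie in `W`. Another player's answers rarely
change under such a resampling, because the player whose view is kept pins them down. But among
three binary answers two agree; if the third player is guessed to be the one asked `1` and this is
right, one of the two answers must have changed. The guess depends on coarse information that leaves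
`ω i` uniform where all three retained questions are `0`, so it is often right. Thus the product of
the three conditional densities of `W` is small on average (`sum_density_le`), while the inverse of
each density has bounded sum over `W`; the arithmetic-geometric mean inequality makes `W` small
(`card_le_of_anticorrelated`). -/

/-- A bound for a sum of products over `τ : ι → T` in which the factors may depend on all of `π ∘ τ`:
it is enough to bound each factor, summed over the fibres of `π`. -/
theorem sum_prod_le_pow_of_fiberwise_le {ι T S : Type*} [Fintype ι] [DecidableEq ι] [Fintype T]
    [DecidableEq T] [Fintype S] [DecidableEq S] (π : T → S) (F : (ι → S) → ι → T → ℝ)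
    (hF : ∀ σ i t, 0 ≤ F σ i t) (M : S → ℝ)
    (h : ∀ σ i, ∑ t with π t = σ i, F σ i t ≤ M (σ i)) :
    ∑ τ : ι → T, ∏ i, F (π ∘ τ) i (τ i) ≤ (∑ s, M s) ^ Fintype.card ι := by
  rw [← Finset.card_univ, ← Finset.prod_const, Finset.prod_univ_sum]
  rw [← Finset.sum_fiberwise (s := Finset.univ) (g := fun τ : ι → T => π ∘ τ)]
  simp only [Fintype.piFinset_univ]
  refine Finset.sum_le_sum fun σ _ => ?_
  calc ∑ τ : ι → T with π ∘ τ = σ, ∏ i, F (π ∘ τ) i (τ i)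
      = ∑ τ ∈ Fintype.piFinset fun i => ({t | π t = σ i} : Finset T), ∏ i, F σ i (τ i) := by
        refine Finset.sum_congr ?_ fun τ hτ => ?_
        · ext τ; simp [funext_iff]
        · have : π ∘ τ = σ := by simpa [funext_iff] using hτ
          rw [this]
    _ = ∏ i, ∑ t with π t = σ i, F σ i t := (Finset.prod_univ_sum _ _).symm
    _ ≤ ∏ i, M (σ i) :=
        Finset.prod_le_prod (fun i _ => Finset.sum_nonneg fun t _ => hF _ _ _) fun i _ => h σ i

theorem sum_arrow_prod {ι A B : Type*} [Fintype ι] [DecidableEq ι] [Fintype A] [Fintype B]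
    (f : (ι → A) → (ι → B) → ℝ) :
    ∑ τ : ι → A × B, f (fun i => (τ i).1) (fun i => (τ i).2) = ∑ a, ∑ b, f a b := by
  rw [← Fintype.sum_prod_type']
  exact Fintype.sum_equiv (Equiv.arrowProdEquivProdArrow ι (fun _ => A) (fun _ => B)) _ _ fun _ => rfl

/-! ### Forced answers and degenerate winning conditions -/

namespace AntiCorrelation

/-- The question to player `j` if player `p` is the one who is asked `1`. -/
def mark (j p : Fin 3) : Fin 2 := if p = j then 1 else 0

/-- The questions to player `j`, where `ω i` is the player who is asked `1` in coordinate `i`. -/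
def view {ι : Type*} (j : Fin 3) (ω : ι → Fin 3) : ι → Fin 2 := fun i => mark j (ω i)

theorem mark_eq_zero {j p : Fin 3} : mark j p = 0 ↔ p ≠ j := by
  unfold mark; split_ifs with h <;> simp [h]

variable {ι : Type*} [Fintype ι] [DecidableEq ι]

theorem card_le_of_forall_ne (W : Finset (ι → Fin 3)) (r : Fin 3) (hW : ∀ ω ∈ W, ∀ i, ω i ≠ r) :
    (W.card : ℝ) ≤ 2 ^ Fintype.card ι := by
  have h : W ⊆ Fintype.piFinset fun _ => Finset.univ.erase r := fun ω hω => by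
    simpa using hW ω hω
  have := Finset.card_le_card h
  rw [Fintype.card_piFinset] at this
  simp at this
  exact_mod_cast this

/-- If player `j` has to answer `γ` whenever player `k` is asked `1`, then the set of coordinates in
which `j` is asked `0` and does not answer `γ` is small. -/
theorem sum_prod_error_le (W : Finset (ι → Fin 3)) (s : (ι → Fin 2) → ι → Fin 2) {j k : Fin 3}
    (γ : Fin 2) (hjk : j ≠ k) (hj : ∀ ω ∈ W, ∀ i, ω i = k → s (view j ω) i = γ) :
    ∑ ω ∈ W, (∏ i, if ω i ≠ j ∧ s (view j ω) i ≠ γ then (7 / 5 : ℝ) else 1) ^ 2 ≤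
      3 ^ Fintype.card ι := by
  -- When `j` sees `0`, two values of `ω i` remain. A deviating answer rules out `k`, so the
  -- survivor may carry weight 2 without changing the fibre total. The factor 7/5 is admissible
  -- because (7/5)² ≤ 2.
  let F : (ι → Fin 2) → ι → Fin 3 → ℝ := fun σ i t =>
    if σ i = 0 ∧ s σ i ≠ γ then (if t = k then 0 else 2) else 1
  have hF : ∀ σ i t, 0 ≤ F σ i t := fun σ i t => by
    simp only [F]; split_ifs <;> norm_num
  have h1 := sum_prod_le_pow_of_fiberwise_le (mark j) F hF (fun x => if x = 0 then 2 else 1) (by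
    intro σ i
    simp only [F]
    generalize σ i = x
    by_cases P : s σ i = γ <;> fin_cases j <;> fin_cases k <;> fin_cases x <;>
      simp [mark, Finset.sum_filter, Fin.sum_univ_three, P, -Finset.sum_boole,
        -Finset.sum_const] at hjk ⊢ <;> norm_num)
  have h2 : (∑ x : Fin 2, if x = 0 then (2 : ℝ) else 1) = 3 := by
    simp [Fin.sum_univ_two]; norm_num
  rw [h2] at h1
  refine le_trans ?_ h1
  refine le_trans (Finset.sum_le_sum fun ω hω => ?_)
    (Finset.sum_le_univ_sum_of_nonneg fun ω => Finset.prod_nonneg fun i _ => hF _ _ _)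
  rw [← Finset.prod_pow]
  refine Finset.prod_le_prod (fun i _ => by positivity) fun i _ => ?_
  have hk := hj ω hω i
  have hv : view j ω i = 0 ↔ ω i ≠ j := mark_eq_zero
  change _ ≤ F (view j ω) i (ω i)
  simp only [F, hv]
  split_ifs with h h' <;> first | exact absurd (hk h') h.2 | norm_num

/-- The average of `∏ q`, over the coordinates in which a player different from `l`, guessed from the
questions to `l`, is asked `1`. -/
theorem sum_prod_guess_le (W : Finset (ι → Fin 3)) (l : Fin 3) (ρ : (ι → Fin 2) → ι → Fin 3)
    (hρ : ∀ σ i, ρ σ i ≠ l) {q : ℝ} (hq : 0 ≤ q) :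
    ∑ ω ∈ W, ∏ i, (if ω i = ρ (view l ω) i then q else 1) ≤ (2 + q) ^ Fintype.card ι := by
  let F : (ι → Fin 2) → ι → Fin 3 → ℝ := fun σ i t => if t = ρ σ i then q else 1
  have hF : ∀ σ i t, 0 ≤ F σ i t := fun σ i t => by
    simp only [F]; split_ifs <;> first | assumption | norm_num
  have h1 := sum_prod_le_pow_of_fiberwise_le (mark l) F hF (fun x => if x = 0 then 1 + q else 1) (by
    intro σ i
    have h := hρ σ i
    simp only [F]
    generalize σ i = x at *
    generalize ρ σ i = y at *
    fin_cases l <;> fin_cases x <;> fin_cases y <;>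
      simp [mark, Finset.sum_filter, Fin.sum_univ_three] at h ⊢ <;> linarith)
  have h2 : (∑ x : Fin 2, if x = 0 then 1 + q else 1) = 2 + q := by
    simp [Fin.sum_univ_two]; ring
  rw [h2] at h1
  exact le_trans
    (Finset.sum_le_univ_sum_of_nonneg fun ω => Finset.prod_nonneg fun i _ => hF (view l ω) _ _) h1

theorem two_le_mul_inv_add_inv_mul {t z : ℝ} (ht : 0 < t) (hz : 0 < z) :
    2 ≤ t * z⁻¹ + t⁻¹ * z := by
  have h : t * z⁻¹ + t⁻¹ * z - 2 = (t - z) ^ 2 / (t * z) := by field_simp; ring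
  have : 0 ≤ (t - z) ^ 2 / (t * z) := by positivity
  linarith

/-- Suppose that player `j` has to answer `γ` whenever `k` is asked `1`, that player `j'` has to
answer `γ'` whenever `k'` is asked `1`, and that one of them deviates from this answer in every
coordinate in which a player guessed from the questions to `l` is asked `1`. Then the questions on
which the players win in every coordinate are exponentially rare. -/
theorem card_le_of_forced_answers (W : Finset (ι → Fin 3)) (s : Fin 3 → (ι → Fin 2) → ι → Fin 2)
    {j k j' k' l : Fin 3} {γ γ' : Fin 2} (hjk : j ≠ k) (hjk' : j' ≠ k')
    (hj : ∀ ω ∈ W, ∀ i, ω i = k → s j (view j ω) i = γ)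
    (hj' : ∀ ω ∈ W, ∀ i, ω i = k' → s j' (view j' ω) i = γ')
    (ρ : (ι → Fin 2) → ι → Fin 3) (hρ : ∀ σ i, ρ σ i ≠ l)
    (h : ∀ ω ∈ W, ∀ i, ω i = ρ (view l ω) i →
      (ω i ≠ j ∧ s j (view j ω) i ≠ γ) ∨ (ω i ≠ j' ∧ s j' (view j' ω) i ≠ γ')) :
    (W.card : ℝ) ≤ (3 * (20 / 21)) ^ Fintype.card ι := by
  set n := Fintype.card ι
  have hD := sum_prod_error_le W (s j) γ hjk hj
  have hE := sum_prod_error_le W (s j') γ' hjk' hj'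
  have hZ := sum_prod_guess_le W l ρ hρ (q := 5 / 7) (by norm_num)
  -- The weight `t` balances the two terms of the arithmetic-geometric mean inequality: 2 + 5/7 ≤ 3
  -- · (20/21)².
  set t : ℝ := (20 / 21) ^ n
  have ht : 0 < t := by positivity
  have hpt : ∀ ω ∈ W, (1 : ℝ) ≤
      t * (((∏ i, if ω i ≠ j ∧ s j (view j ω) i ≠ γ then (7 / 5 : ℝ) else 1) ^ 2
        + (∏ i, if ω i ≠ j' ∧ s j' (view j' ω) i ≠ γ' then (7 / 5 : ℝ) else 1) ^ 2) / 4)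
      + t⁻¹ * (∏ i, (if ω i = ρ (view l ω) i then (5 / 7 : ℝ) else 1)) / 2 := by
    intro ω hω
    -- A correct guess costs 5/7 but comes with a deviation, which contributes 7/5.
    have hx : 1 ≤ (∏ i, if ω i ≠ j ∧ s j (view j ω) i ≠ γ then (7 / 5 : ℝ) else 1)
        * (∏ i, if ω i ≠ j' ∧ s j' (view j' ω) i ≠ γ' then (7 / 5 : ℝ) else 1)
        * (∏ i, (if ω i = ρ (view l ω) i then (5 / 7 : ℝ) else 1)) := by
      rw [← Finset.prod_mul_distrib, ← Finset.prod_mul_distrib]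
      have : ∏ _i : ι, (1 : ℝ) = 1 := Finset.prod_const_one
      rw [← this]
      refine Finset.prod_le_prod (fun _ _ => zero_le_one) fun i _ => ?_
      have := h ω hω i
      split_ifs <;> first | (exfalso; tauto) | norm_num
    have hz : 0 < ∏ i, (if ω i = ρ (view l ω) i then (5 / 7 : ℝ) else 1) :=
      Finset.prod_pos fun i _ => by split_ifs <;> norm_num
    generalize (∏ i, if ω i ≠ j ∧ s j (view j ω) i ≠ γ then (7 / 5 : ℝ) else 1) = x at *
    generalize (∏ i, if ω i ≠ j' ∧ s j' (view j' ω) i ≠ γ' then (7 / 5 : ℝ) else 1) = y at *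
    generalize (∏ i, (if ω i = ρ (view l ω) i then (5 / 7 : ℝ) else 1)) = z at *
    have h1 : z⁻¹ ≤ x * y := by
      rw [inv_le_iff_one_le_mul₀ hz]; linarith
    have h2 : z⁻¹ ≤ (x ^ 2 + y ^ 2) / 2 := by nlinarith [sq_nonneg (x - y)]
    have h3 := two_le_mul_inv_add_inv_mul ht hz
    have h4 := mul_le_mul_of_nonneg_left h2 ht.le
    linarith
  have h1 := Finset.sum_le_sum hpt
  rw [Finset.sum_const, nsmul_eq_mul, mul_one, Finset.sum_add_distrib, ← Finset.mul_sum,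
    ← Finset.sum_div, Finset.sum_add_distrib, ← Finset.sum_div, ← Finset.mul_sum] at h1
  have h2 : t⁻¹ * (2 + 5 / 7) ^ n ≤ 3 ^ n * t := by
    rw [inv_mul_le_iff₀ ht, mul_left_comm, ← mul_pow, ← mul_pow]
    exact pow_le_pow_left₀ (by norm_num) (by norm_num) _
  have h3 := mul_le_mul_of_nonneg_left hZ (inv_pos.2 ht).le
  have h4 := mul_le_mul_of_nonneg_left (add_le_add hD hE) ht.le
  rw [mul_pow]
  change _ ≤ 3 ^ n * t
  linarith

/-- Ways in which the winning conditions of players `p`, `p + 1`, `p + 2` can be unsatisfiable, where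
`Rp y z`, `Rq z x`, `Rr x y` are the conditions on the answers of the two players asked `0`:
`Rp` is never satisfied; or `q` and `r` are forced by `Rr` and `Rq` to answers that violate `Rp`; or
`Rp` forces answers of `q` and `r` which, in `Rr` and `Rq`, exclude different answers of `p`; or `p`
is forced to different answers by `Rq` and `Rr`. -/
def IsDegenerate (Rp Rq Rr : Fin 2 → Fin 2 → Bool) : Prop :=
  (∀ x y, ¬ Rp x y) ∨
  (∃ β γ, (∀ x y, Rr x y → y = β) ∧ (∀ x y, Rq x y → x = γ) ∧ ¬ Rp β γ) ∨
  (∃ β γ g, (∀ x y, Rp x y → x = β ∧ y = γ) ∧ ¬ Rr g β ∧ ¬ Rq γ (g + 1)) ∨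
  (∃ α, (∀ x y, Rq x y → y = α) ∧ (∀ x y, Rr x y → x = α + 1))

set_option maxRecDepth 100000 in
set_option synthInstance.maxSize 10000 in
set_option synthInstance.maxHeartbeats 1000000 in
/-- Binary winning conditions that cannot be satisfied simultaneously are degenerate, or they are
contained in those of the anti-correlation game, after a relabelling of the answers. -/
theorem isDegenerate_or_anticorrelated (R : Fin 3 → Fin 2 → Fin 2 → Bool)
    (h : ∀ t : Fin 3 → Fin 2, ∃ j, R j (t (j + 1)) (t (j + 2)) = false) :
    (∃ p, IsDegenerate (R p) (R (p + 1)) (R (p + 2))) ∨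
      ∃ e : Fin 3 → Fin 2, ∀ j x y, R j x y → x + e (j + 1) ≠ y + e (j + 2) := by
  have h' : ∀ a b c, R 0 b c = false ∨ R 1 c a = false ∨ R 2 a b = false := fun a b c => by
    simpa [Fin.exists_fin_succ] using h ![a, b, c]
  have key : (IsDegenerate (R 0) (R 1) (R 2) ∨ IsDegenerate (R 1) (R 2) (R 0) ∨
        IsDegenerate (R 2) (R 0) (R 1)) ∨
      ∃ a b c, (∀ x y, R 0 x y → x + b ≠ y + c) ∧ (∀ x y, R 1 x y → x + c ≠ y + a) ∧
       (∀ x y, R 2 x y → x + a ≠ y + b) := by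
    clear h
    revert h'
    -- Unrolling every quantifier over `Fin 2` leaves a propositional statement in the twelve
    -- Boolean entries of the relations, which is checked exhaustively.
    have h2 : (1 : Fin 2) + 1 = 0 := rfl
    simp only [IsDegenerate, Fin.forall_fin_two, Fin.exists_fin_two, h2, zero_add, add_zero]
    generalize R 0 0 0 = x1, R 0 0 1 = x2, R 0 1 0 = x3, R 0 1 1 = x4,
      R 1 0 0 = y1, R 1 0 1 = y2, R 1 1 0 = y3, R 1 1 1 = y4,
      R 2 0 0 = z1, R 2 0 1 = z2, R 2 1 0 = z3, R 2 1 1 = z4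
    clear R h2
    simp only [Fin.isValue, ne_eq, not_true_eq_false, imp_false, one_ne_zero, zero_ne_one,
      not_false_eq_true, implies_true, and_true, true_and, Bool.not_eq_true, and_false]
    revert x1 x2 x3 x4 y1 y2 y3 y4 z1 z2 z3 z4
    decide +kernel
  rcases key with h | ⟨a, b, c, h0, h1, h2⟩
  · left
    rcases h with h | h | h
    exacts [⟨0, h⟩, ⟨1, h⟩, ⟨2, h⟩]
  · right
    refine ⟨![a, b, c], fun j => ?_⟩
    fin_cases j
    exacts [h0, h1, h2]

/-- If the winning conditions are degenerate then the questions on which the players win in every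
coordinate are exponentially rare. -/
theorem card_le_of_isDegenerate (R : Fin 3 → Fin 2 → Fin 2 → Bool) (p : Fin 3)
    (hR : IsDegenerate (R p) (R (p + 1)) (R (p + 2)))
    (W : Finset (ι → Fin 3)) (s : Fin 3 → (ι → Fin 2) → ι → Fin 2)
    (hW : ∀ ω ∈ W, ∀ i, R (ω i) (s (ω i + 1) (view (ω i + 1) ω) i)
      (s (ω i + 2) (view (ω i + 2) ω) i)) :
    (W.card : ℝ) ≤ (3 * (20 / 21)) ^ Fintype.card ι := by
  obtain ⟨e1, e2, e3, e4, h1, h2, h3⟩ : p + 1 + 1 = p + 2 ∧ p + 1 + 2 = p ∧ p + 2 + 1 = p ∧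
      p + 2 + 2 = p + 1 ∧ p ≠ p + 1 ∧ p ≠ p + 2 ∧ p + 1 ≠ p + 2 := by
    clear hR; revert p; decide
  have hp : ∀ ω ∈ W, ∀ i, ω i = p →
      R p (s (p + 1) (view (p + 1) ω) i) (s (p + 2) (view (p + 2) ω) i) := fun ω hω i h => by
    have := hW ω hω i
    rwa [h] at this
  have hq : ∀ ω ∈ W, ∀ i, ω i = p + 1 →
      R (p + 1) (s (p + 2) (view (p + 2) ω) i) (s p (view p ω) i) := fun ω hω i h => by
    have := hW ω hω i
    rwa [h, e1, e2] at this
  have hr : ∀ ω ∈ W, ∀ i, ω i = p + 2 →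
      R (p + 2) (s p (view p ω) i) (s (p + 1) (view (p + 1) ω) i) := fun ω hω i h => by
    have := hW ω hω i
    rwa [h, e3, e4] at this
  generalize R p = Rp at *
  generalize R (p + 1) = Rq at *
  generalize R (p + 2) = Rr at *
  rcases hR with h | ⟨β, γ, hβ, hγ, h⟩ | ⟨β, γ, g, hβ, hγ, h⟩ | ⟨α, hα, hα'⟩
  · refine (card_le_of_forall_ne W p fun ω hω i hi => h _ _ (hp ω hω i hi)).trans ?_
    exact pow_le_pow_left₀ (by norm_num) (by norm_num) _
  · refine card_le_of_forced_answers W s (l := p + 1) h3 h3.symm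
      (fun ω hω i hi => hβ _ _ (hr ω hω i hi)) (fun ω hω i hi => hγ _ _ (hq ω hω i hi))
      (fun _ _ => p) (fun _ _ => h1) fun ω hω i hi => ?_
    have h4 := hp ω hω i hi
    by_contra! hc
    rw [hc.1 (hi ▸ h1), hc.2 (hi ▸ h2)] at h4
    exact h h4
  · refine card_le_of_forced_answers W s (l := p) h1.symm h2.symm
      (fun ω hω i hi => (hβ _ _ (hp ω hω i hi)).1) (fun ω hω i hi => (hβ _ _ (hp ω hω i hi)).2)
      -- Player `p` picks the relation that its own answer makes incompatible with the forced answer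
      -- of the remaining player.
      (fun σ i => if s p σ i = g then p + 2 else p + 1)
      (fun σ i => by split_ifs; exacts [h2.symm, h1.symm]) fun ω hω i hi => ?_
    by_contra! hc
    split_ifs at hi with hg
    · have h4 := hr ω hω i hi
      rw [hg, hc.1 (hi ▸ h3.symm)] at h4
      exact hγ h4
    · have h4 := hq ω hω i hi
      have hg' : s p (view p ω) i = g + 1 := by omega
      rw [hg', hc.2 (hi ▸ h3)] at h4
      exact h h4
  -- Both deviations are those of `p` itself: whenever it is asked `0`, it misses `α` or `α + 1`.
  -- Any guess other than `p` would do.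
  · refine card_le_of_forced_answers W s (l := p) h1 h2
      (fun ω hω i hi => hα _ _ (hq ω hω i hi)) (fun ω hω i hi => hα' _ _ (hr ω hω i hi))
      (fun _ _ => p + 1) (fun _ _ => h1.symm) fun ω hω i hi => ?_
    have h4 : ω i ≠ p := hi ▸ h1.symm
    simp only [ne_eq, h4, not_false_eq_true, true_and]
    by_contra! hc
    rw [hc.1] at hc
    have := hc.2
    omega

end AntiCorrelation

/-! ### Resampling given one player's questions -/

namespace AntiCorrelation

variable {ι : Type*} [Fintype ι]

/-- The transition probabilities of the chain that resamples the player who is asked `1`, given the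
question to player `j`. -/
noncomputable def kernel (j p p' : Fin 3) : ℝ :=
  if p = j then (if p' = j then 1 else 0) else (if p' = j then 0 else 1 / 2)

theorem kernel_nonneg (j p p' : Fin 3) : 0 ≤ kernel j p p' := by
  unfold kernel; split_ifs <;> norm_num

theorem kernel_comm (j p p' : Fin 3) : kernel j p p' = kernel j p' p := by
  unfold kernel; split_ifs <;> rfl

theorem kernel_self_pos (j p : Fin 3) : 0 < kernel j p p := by
  unfold kernel; split_ifs <;> norm_num

theorem sum_kernel (j p : Fin 3) : ∑ p', kernel j p p' = 1 := by
  unfold kernel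
  fin_cases j <;> fin_cases p <;> simp [Fin.sum_univ_three, -Finset.sum_boole] <;> norm_num

theorem mark_eq_of_kernel_ne_zero {j p p' : Fin 3} (h : kernel j p p' ≠ 0) :
    mark j p = mark j p' := by
  unfold kernel at h
  unfold mark
  split_ifs at h ⊢ <;> simp_all

theorem kernel_congr {j p p' : Fin 3} (h : mark j p = mark j p') : kernel j p = kernel j p' := by
  funext t
  unfold mark at h
  unfold kernel
  split_ifs at h ⊢ <;> simp_all

/-- The probability that resampling all coordinates of `ω`, given the questions to player `j`, leads
to `ω'`. -/
noncomputable def resample (j : Fin 3) (ω ω' : ι → Fin 3) : ℝ := ∏ i, kernel j (ω i) (ω' i)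

theorem resample_nonneg (j : Fin 3) (ω ω' : ι → Fin 3) : 0 ≤ resample j ω ω' :=
  Finset.prod_nonneg fun _ _ => kernel_nonneg _ _ _

theorem resample_comm (j : Fin 3) (ω ω' : ι → Fin 3) : resample j ω ω' = resample j ω' ω :=
  Finset.prod_congr rfl fun _ _ => kernel_comm _ _ _

theorem sum_resample [DecidableEq ι] (j : Fin 3) (ω : ι → Fin 3) : ∑ ω', resample j ω ω' = 1 := by
  have := Finset.prod_univ_sum (fun _ : ι => (Finset.univ : Finset (Fin 3)))
    (fun i t => kernel j (ω i) t)
  rw [Fintype.piFinset_univ] at this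
  unfold resample
  rw [← this]
  exact Finset.prod_eq_one fun i _ => sum_kernel _ _

theorem view_eq_of_resample_ne_zero {j : Fin 3} {ω ω' : ι → Fin 3} (h : resample j ω ω' ≠ 0) :
    view j ω = view j ω' :=
  funext fun i => mark_eq_of_kernel_ne_zero (Finset.prod_ne_zero_iff.1 h i (Finset.mem_univ i))

theorem resample_congr {j : Fin 3} {ω ω' : ι → Fin 3} (h : view j ω = view j ω') :
    resample j ω = resample j ω' := by
  funext τ
  exact Finset.prod_congr rfl fun i _ => congrFun (kernel_congr (congrFun h i)) _

/-- The conditional probability of `W` given the questions to player `j`. -/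
noncomputable def density (W : Finset (ι → Fin 3)) (j : Fin 3) (ω : ι → Fin 3) : ℝ :=
  ∑ ω' ∈ W, resample j ω ω'

theorem density_nonneg (W : Finset (ι → Fin 3)) (j : Fin 3) (ω : ι → Fin 3) : 0 ≤ density W j ω :=
  Finset.sum_nonneg fun _ _ => resample_nonneg _ _ _

theorem density_le_one [DecidableEq ι] (W : Finset (ι → Fin 3)) (j : Fin 3) (ω : ι → Fin 3) :
    density W j ω ≤ 1 :=
  (Finset.sum_le_univ_sum_of_nonneg fun _ => resample_nonneg _ _ _).trans_eq (sum_resample j ω)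

theorem density_pos {W : Finset (ι → Fin 3)} {ω : ι → Fin 3} (h : ω ∈ W) (j : Fin 3) :
    0 < density W j ω :=
  Finset.sum_pos' (fun _ _ => resample_nonneg _ _ _)
    ⟨ω, h, Finset.prod_pos fun _ _ => kernel_self_pos _ _⟩

variable [DecidableEq ι]

/-- The density is constant on each class of tuples with the same view for `j`, so a class meeting
`W` contributes exactly its size. Symmetry of the resampling kernel expresses this as a double
count. -/
theorem sum_inv_density_le (W : Finset (ι → Fin 3)) (j : Fin 3) :
    ∑ ω ∈ W, (density W j ω)⁻¹ ≤ 3 ^ Fintype.card ι := by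
  calc ∑ ω ∈ W, (density W j ω)⁻¹
      = ∑ ω ∈ W, ∑ ω', resample j ω ω' * (density W j ω)⁻¹ :=
        Finset.sum_congr rfl fun ω _ => by rw [← Finset.sum_mul, sum_resample, one_mul]
    _ = ∑ ω', ∑ ω ∈ W, resample j ω' ω * (density W j ω')⁻¹ := by
        rw [Finset.sum_comm]
        refine Finset.sum_congr rfl fun ω' _ => Finset.sum_congr rfl fun ω _ => ?_
        rw [resample_comm j ω ω']
        by_cases h : resample j ω' ω = 0
        · rw [h, zero_mul, zero_mul]
        · rw [density, density, resample_congr (view_eq_of_resample_ne_zero h)]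
    _ ≤ ∑ _ω' : ι → Fin 3, (1 : ℝ) := Finset.sum_le_sum fun ω' _ => by
        rw [← Finset.sum_mul]
        exact mul_inv_le_one
    _ = 3 ^ Fintype.card ι := by simp

/-- The factor `c` in the coordinates in which player `j` is asked `0` both times and gives different
answers. -/
noncomputable def deviation (s : (ι → Fin 2) → ι → Fin 2) (j : Fin 3) (c : ℝ) (ω ω' : ι → Fin 3)
    (i : ι) : ℝ :=
  if ω i ≠ j ∧ ω' i ≠ j ∧ s (view j ω) i ≠ s (view j ω') i then c else 1

/-- The answers of player `j` mostly agree on two winning tuples of questions that look the same to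
another player. -/
theorem sum_resample_mul_deviation_le (W : Finset (ι → Fin 3))
    (s : Fin 3 → (ι → Fin 2) → ι → Fin 2) {j k : Fin 3} (hjk : j ≠ k)
    (hW : ∀ ω ∈ W, ∀ i, j ≠ ω i → k ≠ ω i → s j (view j ω) i ≠ s k (view k ω) i) :
    ∑ ω ∈ W, ∑ ω' ∈ W, resample k ω ω' * (∏ i, deviation (s j) j (8 / 7) ω ω' i) ^ 3 ≤
      3 ^ Fintype.card ι := by
  -- Where `j` is asked `0` twice, the kernel mass is 1 on `(k, k)` and 1/2 on the third player
  -- twice. A change of answer leaves only `(k, k)`, which may then be weighted by 3/2; note (8/7)³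
  -- ≤ 3/2.
  let F : (ι → Fin 2 × Fin 2) → ι → Fin 3 × Fin 3 → ℝ := fun σ i t => kernel k t.1 t.2 *
    if σ i = (0, 0) ∧ s j (fun i => (σ i).1) i ≠ s j (fun i => (σ i).2) i
      then (if t.1 = k then 3 / 2 else 0) else 1
  have hF : ∀ σ i t, 0 ≤ F σ i t := fun σ i t =>
    mul_nonneg (kernel_nonneg _ _ _) (by split_ifs <;> norm_num)
  have h1 := sum_prod_le_pow_of_fiberwise_le (fun t => (mark j t.1, mark j t.2)) F hF
    (fun x => if x = (0, 0) then 3 / 2 else 1 / 2) (by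
      intro σ i
      simp only [F]
      generalize σ i = x
      clear hW
      generalize s j (fun i => (σ i).1) i = y, s j (fun i => (σ i).2) i = y'
      by_cases P : y = y' <;> fin_cases j <;> fin_cases k <;> fin_cases x <;>
        simp [mark, kernel, Finset.sum_filter, Fintype.sum_prod_type, Fin.sum_univ_three, P,
          -Finset.sum_boole, -Finset.sum_const] at hjk ⊢ <;> norm_num)
  have h2 : (∑ x : Fin 2 × Fin 2, if x = (0, 0) then (3 / 2 : ℝ) else 1 / 2) = 3 := by
    simp [Fin.sum_univ_two, Fintype.sum_prod_type]; norm_num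
  rw [h2] at h1
  have h3 : ∑ τ : ι → Fin 3 × Fin 3, ∏ i, F ((fun t => (mark j t.1, mark j t.2)) ∘ τ) i (τ i) =
      ∑ ω, ∑ ω', ∏ i, F (fun i => (view j ω i, view j ω' i)) i (ω i, ω' i) :=
    sum_arrow_prod fun ω ω' => ∏ i, F (fun i => (view j ω i, view j ω' i)) i (ω i, ω' i)
  rw [h3] at h1
  refine le_trans ?_ h1
  have hpos : ∀ ω ω', 0 ≤ ∏ i, F (fun i => (view j ω i, view j ω' i)) i (ω i, ω' i) :=
    fun ω ω' => Finset.prod_nonneg fun i _ =>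
      hF (fun i => (view j ω i, view j ω' i)) i (ω i, ω' i)
  refine le_trans (Finset.sum_le_sum fun ω hω => ?_)
    (Finset.sum_le_univ_sum_of_nonneg fun ω => Finset.sum_nonneg fun ω' _ => hpos ω ω')
  refine le_trans (Finset.sum_le_sum fun ω' hω' => ?_)
    (Finset.sum_le_univ_sum_of_nonneg fun ω' => hpos ω ω')
  by_cases h : resample k ω ω' = 0
  · rw [h, zero_mul]
    exact hpos ω ω'
  have hv := view_eq_of_resample_ne_zero h
  rw [resample, ← Finset.prod_pow, ← Finset.prod_mul_distrib]
  refine Finset.prod_le_prod (fun i _ => mul_nonneg (kernel_nonneg _ _ _) (by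
    unfold deviation; split_ifs <;> norm_num)) fun i _ => ?_
  refine mul_le_mul_of_nonneg_left ?_ (kernel_nonneg _ _ _)
  have hi : (view j ω i, view j ω' i) = ((0 : Fin 2), (0 : Fin 2)) ↔ ω i ≠ j ∧ ω' i ≠ j := by
    rw [Prod.mk.injEq]
    exact and_congr mark_eq_zero mark_eq_zero
  simp only [deviation, hi, and_assoc]
  split_ifs with hd hk
  · norm_num
  · exfalso
    -- If `k` were asked `0`, its answer, the same for both tuples, would differ from two different
    -- bits.
    have hk' : ω' i ≠ k :=
      mark_eq_zero.1 ((congrFun hv i).symm.trans (mark_eq_zero.2 hk))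
    have e1 := hW ω hω i hd.1.symm (Ne.symm hk)
    have e2 := hW ω' hω' i hd.2.1.symm hk'.symm
    rw [← hv] at e2
    have e3 : s j (view j ω) i ≠ s j (view j ω') i := hd.2.2
    omega
  · norm_num

/-- Even a guess from coarse information about one resampling for each player tells only with limited
probability which player is asked `1`. -/
theorem sum_resample_mul_guess_le (ρ : (ι → Fin 2 × Fin 2 × Fin 2) → ι → Fin 3) :
    ∑ ω : ι → Fin 3, ∑ a, ∑ b, ∑ c, resample 1 ω a * resample 2 ω b * resample 0 ω c *
      ∏ i, (if (view 0 a i, view 1 b i, view 2 c i) = ((0 : Fin 2), (0 : Fin 2), (0 : Fin 2)) ∧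
        ω i = ρ (fun i => (view 0 a i, view 1 b i, view 2 c i)) i then (7 / 8 : ℝ) else 1) ≤
      (3 * (95 / 96)) ^ Fintype.card ι := by
  let F : (ι → Fin 2 × Fin 2 × Fin 2) → ι → Fin 3 × Fin 3 × Fin 3 × Fin 3 → ℝ := fun σ i t =>
    kernel 1 t.1 t.2.1 * kernel 2 t.1 t.2.2.1 * kernel 0 t.1 t.2.2.2 *
      if σ i = (0, 0, 0) ∧ t.1 = ρ σ i then 7 / 8 else 1
  have hF : ∀ σ i t, 0 ≤ F σ i t := fun σ i t =>
    mul_nonneg (mul_nonneg (mul_nonneg (kernel_nonneg _ _ _) (kernel_nonneg _ _ _))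
      (kernel_nonneg _ _ _)) (by split_ifs <;> norm_num)
  -- Given coarse information `(0, 0, 0)`, each of the three values of `ω i` has mass 1/4, so any
  -- guess gains the factor 7/8 on mass 1/4. This lowers the total from 3 to 3 - 1/32.
  have h1 := sum_prod_le_pow_of_fiberwise_le
    (fun t => (mark 0 t.2.1, mark 1 t.2.2.1, mark 2 t.2.2.2)) F hF
    (fun x => if x = (0, 0, 0) then (2 + 7 / 8) / 4 else
      ((if x.1 = 0 then 1 else 0) + (if x.2.1 = 0 then 1 else 0) +
        (if x.2.2 = 0 then 1 else 0)) / 4) (by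
      intro σ i
      simp only [F]
      generalize σ i = x
      generalize ρ σ i = r
      fin_cases x <;> fin_cases r <;>
        simp [mark, kernel, Finset.sum_filter, Fintype.sum_prod_type, Fin.sum_univ_three,
          -Finset.sum_boole, -Finset.sum_const] <;> norm_num)
  have h2 : (∑ x : Fin 2 × Fin 2 × Fin 2, if x = (0, 0, 0) then ((2 + 7 / 8) / 4 : ℝ) else
      ((if x.1 = 0 then 1 else 0) + (if x.2.1 = 0 then 1 else 0) +
        (if x.2.2 = 0 then 1 else 0)) / 4) = 3 * (95 / 96) := by
    simp [Fin.sum_univ_two, Fintype.sum_prod_type, -Finset.sum_boole]; norm_num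
  rw [h2] at h1
  refine le_trans (le_of_eq ?_) h1
  let f : (ι → Fin 3) → (ι → Fin 3) → (ι → Fin 3) → (ι → Fin 3) → ℝ := fun ω a b c =>
    ∏ i, F (fun i => (view 0 a i, view 1 b i, view 2 c i)) i (ω i, a i, b i, c i)
  have h3 : ∑ τ : ι → Fin 3 × Fin 3 × Fin 3 × Fin 3,
      ∏ i, F ((fun t => (mark 0 t.2.1, mark 1 t.2.2.1, mark 2 t.2.2.2)) ∘ τ) i (τ i) =
      ∑ ω, ∑ a, ∑ b, ∑ c, f ω a b c := by
    refine (sum_arrow_prod fun ω (τ : ι → Fin 3 × Fin 3 × Fin 3) =>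
      f ω (fun i => (τ i).1) (fun i => (τ i).2.1) (fun i => (τ i).2.2)).trans ?_
    refine Finset.sum_congr rfl fun ω _ => ?_
    refine (sum_arrow_prod fun a (τ : ι → Fin 3 × Fin 3) =>
      f ω a (fun i => (τ i).1) (fun i => (τ i).2)).trans ?_
    exact Finset.sum_congr rfl fun a _ => sum_arrow_prod fun b c => f ω a b c
  rw [h3]
  refine Finset.sum_congr rfl fun ω _ => Finset.sum_congr rfl fun a _ =>
    Finset.sum_congr rfl fun b _ => Finset.sum_congr rfl fun c _ => ?_
  simp only [f, F, resample, ← Finset.prod_mul_distrib]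

end AntiCorrelation

/-! ### Mean inequalities and the anti-correlated case -/

theorem four_le_add_of_mul_eq_one {a b c d : ℝ} (ha : 0 < a) (hb : 0 < b) (hc : 0 < c) (hd : 0 < d)
    (h : a * b * c * d = 1) : 4 ≤ a + b + c + d := by
  have h1 : 4 * (a * b) ≤ (a + b) ^ 2 := by nlinarith [sq_nonneg (a - b)]
  have h2 : 4 * (c * d) ≤ (c + d) ^ 2 := by nlinarith [sq_nonneg (c - d)]
  have h3 : (4 : ℝ) ^ 2 ≤ ((a + b) * (c + d)) ^ 2 := by
    rw [mul_pow]
    refine le_trans (le_of_eq ?_) (mul_le_mul h1 h2 (by positivity) (by positivity))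
    linear_combination (-16) * h
  have h4 : 4 ≤ (a + b) * (c + d) := (sq_le_sq₀ (by norm_num) (by positivity)).1 h3
  refine (sq_le_sq₀ (by norm_num) (by positivity)).1 ?_
  nlinarith [sq_nonneg (a + b - (c + d))]

theorem mul_mul_le_sum_cube_div_three {x y z : ℝ} (hx : 0 ≤ x) (hy : 0 ≤ y) (hz : 0 ≤ z) :
    x * y * z ≤ (x ^ 3 + y ^ 3 + z ^ 3) / 3 := by
  have : x ^ 3 + y ^ 3 + z ^ 3 - 3 * (x * y * z) =
      (x + y + z) * ((x - y) ^ 2 + (y - z) ^ 2 + (z - x) ^ 2) / 2 := by ring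
  have : 0 ≤ (x + y + z) * ((x - y) ^ 2 + (y - z) ^ 2 + (z - x) ^ 2) / 2 := by positivity
  linarith

namespace AntiCorrelation

variable {ι : Type*} [Fintype ι] [DecidableEq ι]

theorem sum_product_mul {Ω : Type*} (W : Finset Ω) (f g h : Ω → Ω → ℝ) :
    ∑ q ∈ W ×ˢ W ×ˢ W ×ˢ W, f q.1 q.2.1 * g q.1 q.2.2.1 * h q.1 q.2.2.2 =
      ∑ ω ∈ W, (∑ a ∈ W, f ω a) * (∑ b ∈ W, g ω b) * ∑ c ∈ W, h ω c := by
  simp only [Finset.sum_product]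
  refine Finset.sum_congr rfl fun ω _ => ?_
  rw [Finset.sum_mul_sum, Finset.sum_mul]
  refine Finset.sum_congr rfl fun a _ => ?_
  rw [Finset.sum_mul_sum]

/-- If any two players who are asked `0` have to give different answers, then the winning tuples of
questions are rarely surrounded by other winning tuples. -/
theorem sum_density_le (W : Finset (ι → Fin 3)) (s : Fin 3 → (ι → Fin 2) → ι → Fin 2)
    (hW : ∀ ω ∈ W, ∀ i j k, j ≠ k → j ≠ ω i → k ≠ ω i → s j (view j ω) i ≠ s k (view k ω) i) :
    ∑ ω ∈ W, density W 1 ω * density W 2 ω * density W 0 ω ≤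
      3 ^ Fintype.card ι * (191 / 192) ^ Fintype.card ι := by
  set n := Fintype.card ι
  let u : (ι → Fin 2 × Fin 2 × Fin 2) → Fin 3 → ι → Fin 2 := fun σ =>
    ![s 0 fun i => (σ i).1, s 1 fun i => (σ i).2.1, s 2 fun i => (σ i).2.2]
  -- Two of three bits agree; the guess is the player outside such a pair.
  let ρ : (ι → Fin 2 × Fin 2 × Fin 2) → ι → Fin 3 := fun σ i =>
    if u σ 0 i = u σ 1 i then 2 else if u σ 1 i = u σ 2 i then 0 else 1
  let x : Fin 3 → (ι → Fin 3) → (ι → Fin 3) → ℝ := fun j ω a => ∏ i, deviation (s j) j (8 / 7) ω a i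
  have hx0 : ∀ j ω a, 0 ≤ x j ω a := fun j ω a => Finset.prod_nonneg fun i _ => by
    unfold deviation; split_ifs <;> norm_num
  let w : (ι → Fin 3) → (ι → Fin 3) → (ι → Fin 3) → (ι → Fin 3) → ℝ := fun ω a b c =>
    ∏ i, (if (view 0 a i, view 1 b i, view 2 c i) = ((0 : Fin 2), (0 : Fin 2), (0 : Fin 2)) ∧
        ω i = ρ (fun i => (view 0 a i, view 1 b i, view 2 c i)) i then (7 / 8 : ℝ) else 1)
  have hw0 : ∀ ω a b c, 0 < w ω a b c := fun ω a b c => Finset.prod_pos fun i _ => by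
    split_ifs <;> norm_num
  let K : (ι → Fin 3) → (ι → Fin 3) → (ι → Fin 3) → (ι → Fin 3) → ℝ := fun ω a b c =>
    resample 1 ω a * resample 2 ω b * resample 0 ω c
  have hK0 : ∀ ω a b c, 0 ≤ K ω a b c := fun ω a b c =>
    mul_nonneg (mul_nonneg (resample_nonneg _ _ _) (resample_nonneg _ _ _)) (resample_nonneg _ _ _)
  let S := W ×ˢ W ×ˢ W ×ˢ W
  have hxw : ∀ ω ∈ W, ∀ a b c, 1 ≤ x 0 ω a * x 1 ω b * x 2 ω c * w ω a b c := by
    intro ω hω a b c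
    simp only [x, w, ← Finset.prod_mul_distrib]
    have : ∏ _i : ι, (1 : ℝ) = 1 := Finset.prod_const_one
    refine this.ge.trans (Finset.prod_le_prod (fun _ _ => zero_le_one) fun i _ => ?_)
    have hd : ∀ j (a : ι → Fin 3), 1 ≤ deviation (s j) j (8 / 7) ω a i := fun j a => by
      unfold deviation; split_ifs <;> norm_num
    have h0 := hd 0 a
    have h1 := hd 1 b
    have h2 := hd 2 c
    split_ifs with hb
    · obtain ⟨hz, hr⟩ := hb
      simp only [Prod.mk.injEq] at hz
      obtain ⟨za, zb, zc⟩ := hz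
      replace za : a i ≠ 0 := mark_eq_zero.1 za
      replace zb : b i ≠ 1 := mark_eq_zero.1 zb
      replace zc : c i ≠ 2 := mark_eq_zero.1 zc
      -- If the guess is right, the other two players are asked `0` in `ω` and answer differently
      -- there, although their answers after resampling agree. Hence one of them changed its answer.
      have key : deviation (s 0) 0 (8 / 7) ω a i = 8 / 7 ∨ deviation (s 1) 1 (8 / 7) ω b i = 8 / 7 ∨
          deviation (s 2) 2 (8 / 7) ω c i = 8 / 7 := by
        have hW' := hW ω hω i
        by_contra! hc
        simp only [deviation, ne_eq, ite_eq_left_iff, not_forall, exists_prop] at hc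
        obtain ⟨⟨c0, -⟩, ⟨c1, -⟩, c2, -⟩ := hc
        change ω i = if s 0 (view 0 a) i = s 1 (view 1 b) i then 2 else
          if s 1 (view 1 b) i = s 2 (view 2 c) i then 0 else 1 at hr
        have w01 := hW' 0 1 (by decide)
        have w12 := hW' 1 2 (by decide)
        have w02 := hW' 0 2 (by decide)
        split_ifs at hr with e1 e2
        · rw [hr] at c0 c1 w01
          simp [za, zb] at c0 c1 w01
          omega
        · rw [hr] at c1 c2 w12
          simp [zb, zc] at c1 c2 w12
          omega
        · rw [hr] at c0 c2 w02
          simp [za, zc] at c0 c2 w02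
          omega
      have h01 : 1 ≤ deviation (s 0) 0 (8 / 7) ω a i * deviation (s 1) 1 (8 / 7) ω b i :=
        one_le_mul_of_one_le_of_one_le h0 h1
      rcases key with h | h | h
      · rw [h] at h01 ⊢
        nlinarith
      · rw [h] at h01 ⊢
        nlinarith
      · rw [h]
        nlinarith
    · rw [mul_one]
      exact one_le_mul_of_one_le_of_one_le (one_le_mul_of_one_le_of_one_le h0 h1) h2
  have hdev : ∀ j k, j ≠ k → ∑ ω ∈ W, ∑ a ∈ W, resample k ω a * x j ω a ^ 3 ≤ 3 ^ n := fun j k hjk =>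
    sum_resample_mul_deviation_le W s hjk fun ω hω i => hW ω hω i j k hjk
  have hnn : ∀ j k ω, 0 ≤ ∑ a ∈ W, resample k ω a * x j ω a ^ 3 := fun j k ω =>
    Finset.sum_nonneg fun a _ => mul_nonneg (resample_nonneg _ _ _) (pow_nonneg (hx0 _ _ _) _)
  have h0 : ∑ q ∈ S, K q.1 q.2.1 q.2.2.1 q.2.2.2 * x 0 q.1 q.2.1 ^ 3 ≤ 3 ^ n := by
    have e := sum_product_mul W (fun ω a => resample 1 ω a * x 0 ω a ^ 3) (resample 2) (resample 0)
    refine le_trans (le_of_eq ?_) (e.trans_le (Finset.sum_le_sum fun ω _ => ?_) |>.trans (hdev 0 1 (by decide)))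
    · exact Finset.sum_congr rfl fun q _ => by simp only [K]; ring
    · exact mul_le_of_le_one_right (mul_nonneg (hnn 0 1 ω) (density_nonneg W 2 ω))
        (density_le_one W 0 ω) |>.trans (mul_le_of_le_one_right (hnn 0 1 ω) (density_le_one W 2 ω))
  have h1 : ∑ q ∈ S, K q.1 q.2.1 q.2.2.1 q.2.2.2 * x 1 q.1 q.2.2.1 ^ 3 ≤ 3 ^ n := by
    have e := sum_product_mul W (resample 1) (fun ω a => resample 2 ω a * x 1 ω a ^ 3) (resample 0)
    refine le_trans (le_of_eq ?_) (e.trans_le (Finset.sum_le_sum fun ω _ => ?_) |>.trans (hdev 1 2 (by decide)))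
    · exact Finset.sum_congr rfl fun q _ => by simp only [K]; ring
    · exact mul_le_of_le_one_right (mul_nonneg (density_nonneg W 1 ω) (hnn 1 2 ω))
        (density_le_one W 0 ω) |>.trans (mul_le_of_le_one_left (hnn 1 2 ω) (density_le_one W 1 ω))
  have h2 : ∑ q ∈ S, K q.1 q.2.1 q.2.2.1 q.2.2.2 * x 2 q.1 q.2.2.2 ^ 3 ≤ 3 ^ n := by
    have e := sum_product_mul W (resample 1) (resample 2) (fun ω a => resample 0 ω a * x 2 ω a ^ 3)
    refine le_trans (le_of_eq ?_) (e.trans_le (Finset.sum_le_sum fun ω _ => ?_) |>.trans (hdev 2 0 (by decide)))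
    · exact Finset.sum_congr rfl fun q _ => by simp only [K]; ring
    · exact mul_le_of_le_one_left (hnn 2 0 ω)
        (mul_le_one₀ (density_le_one W 1 ω) (density_nonneg W 2 ω) (density_le_one W 2 ω))
  have h3 : ∑ q ∈ S, K q.1 q.2.1 q.2.2.1 q.2.2.2 * w q.1 q.2.1 q.2.2.1 q.2.2.2 ≤
      (3 * (95 / 96)) ^ n := by
    refine le_trans (Finset.sum_le_univ_sum_of_nonneg fun q =>
      mul_nonneg (hK0 _ _ _ _) (hw0 _ _ _ _).le) ?_
    simp only [Fintype.sum_prod_type]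
    exact sum_resample_mul_guess_le ρ
  -- Chosen so that 95/96 ≤ (191/192)², which balances the two terms below.
  set t : ℝ := (191 / 192) ^ n
  have ht : 0 < t := by positivity
  have hpt : ∀ q ∈ S, K q.1 q.2.1 q.2.2.1 q.2.2.2 ≤
      t * (K q.1 q.2.1 q.2.2.1 q.2.2.2 * x 0 q.1 q.2.1 ^ 3 +
        K q.1 q.2.1 q.2.2.1 q.2.2.2 * x 1 q.1 q.2.2.1 ^ 3 +
        K q.1 q.2.1 q.2.2.1 q.2.2.2 * x 2 q.1 q.2.2.2 ^ 3) / 6 +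
      t⁻¹ * (K q.1 q.2.1 q.2.2.1 q.2.2.2 * w q.1 q.2.1 q.2.2.1 q.2.2.2) / 2 := by
    intro q hq
    have e1 := hxw q.1 (Finset.mem_product.1 hq).1 q.2.1 q.2.2.1 q.2.2.2
    have e2 := mul_mul_le_sum_cube_div_three (hx0 0 q.1 q.2.1) (hx0 1 q.1 q.2.2.1)
      (hx0 2 q.1 q.2.2.2)
    have e3 := hw0 q.1 q.2.1 q.2.2.1 q.2.2.2
    have e4 := hK0 q.1 q.2.1 q.2.2.1 q.2.2.2
    generalize w q.1 q.2.1 q.2.2.1 q.2.2.2 = w at *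
    generalize K q.1 q.2.1 q.2.2.1 q.2.2.2 = K at *
    generalize x 0 q.1 q.2.1 = x0, x 1 q.1 q.2.2.1 = x1, x 2 q.1 q.2.2.2 = x2 at *
    have e5 : w⁻¹ ≤ (x0 ^ 3 + x1 ^ 3 + x2 ^ 3) / 3 := by
      refine le_trans ?_ e2
      rw [inv_le_iff_one_le_mul₀ e3]
      linarith
    have e6 := two_le_mul_inv_add_inv_mul ht e3
    have e7 := mul_le_mul_of_nonneg_left e5 ht.le
    have e8 : 1 ≤ t * ((x0 ^ 3 + x1 ^ 3 + x2 ^ 3) / 3) / 2 + t⁻¹ * w / 2 := by linarith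
    have e9 := mul_le_mul_of_nonneg_left e8 e4
    linarith
  have h4 := Finset.sum_le_sum hpt
  rw [Finset.sum_add_distrib, ← Finset.sum_div, ← Finset.sum_div, ← Finset.mul_sum,
    ← Finset.mul_sum, Finset.sum_add_distrib, Finset.sum_add_distrib] at h4
  have h5 : ∑ q ∈ S, K q.1 q.2.1 q.2.2.1 q.2.2.2 =
      ∑ ω ∈ W, density W 1 ω * density W 2 ω * density W 0 ω :=
    sum_product_mul W (resample 1) (resample 2) (resample 0)
  rw [h5] at h4
  have h6 : t⁻¹ * (3 * (95 / 96)) ^ n ≤ 3 ^ n * t := by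
    rw [inv_mul_le_iff₀ ht, mul_left_comm, ← mul_pow, ← mul_pow]
    exact pow_le_pow_left₀ (by norm_num) (by norm_num) _
  have h7 := mul_le_mul_of_nonneg_left h3 (inv_pos.2 ht).le
  have h8 := mul_le_mul_of_nonneg_left (add_le_add (add_le_add h0 h1) h2) ht.le
  linarith

/-- If any two players who are asked `0` have to give different answers, then the questions on which
the players win in every coordinate are exponentially rare. -/
theorem card_le_of_anticorrelated (W : Finset (ι → Fin 3)) (s : Fin 3 → (ι → Fin 2) → ι → Fin 2)
    (hW : ∀ ω ∈ W, ∀ i j k, j ≠ k → j ≠ ω i → k ≠ ω i → s j (view j ω) i ≠ s k (view k ω) i) :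
    (W.card : ℝ) ≤ (3 * (767 / 768)) ^ Fintype.card ι := by
  have hE := sum_density_le W s hW
  set n := Fintype.card ι
  -- A fourth root suffices, since 191/192 ≤ (767/768)⁴: the four terms in `hpt` multiply to 1 and
  -- each then sums to at most `3 ^ n * v`.
  set v : ℝ := (767 / 768) ^ n
  have hv : 0 < v := by positivity
  have hvE : ∑ ω ∈ W, density W 1 ω * density W 2 ω * density W 0 ω ≤ 3 ^ n * v ^ 4 := by
    refine hE.trans (mul_le_mul_of_nonneg_left ?_ (by positivity))
    rw [← pow_mul, mul_comm n, pow_mul]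
    exact pow_le_pow_left₀ (by norm_num) (by norm_num) _
  have hpt : ∀ ω ∈ W, (1 : ℝ) ≤ (v⁻¹ ^ 3 * (density W 1 ω * density W 2 ω * density W 0 ω)
      + v * ((density W 1 ω)⁻¹ + (density W 2 ω)⁻¹ + (density W 0 ω)⁻¹)) / 4 := by
    intro ω hω
    have h0 := density_pos hω 0
    have h1 := density_pos hω 1
    have h2 := density_pos hω 2
    generalize density W 0 ω = d0 at *
    generalize density W 1 ω = d1 at *
    generalize density W 2 ω = d2 at *
    have := four_le_add_of_mul_eq_one (a := v⁻¹ ^ 3 * (d1 * d2 * d0)) (b := v * d1⁻¹)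
      (c := v * d2⁻¹) (d := v * d0⁻¹) (by positivity) (by positivity) (by positivity)
      (by positivity) (by field_simp)
    linarith
  have h1 := Finset.sum_le_sum hpt
  rw [Finset.sum_const, nsmul_eq_mul, mul_one, ← Finset.sum_div, Finset.sum_add_distrib,
    ← Finset.mul_sum, ← Finset.mul_sum, Finset.sum_add_distrib, Finset.sum_add_distrib] at h1
  have h2 := mul_le_mul_of_nonneg_left hvE (a := v⁻¹ ^ 3) (by positivity)
  have h3 : v⁻¹ ^ 3 * (3 ^ n * v ^ 4) = 3 ^ n * v := by field_simp
  have h4 := mul_le_mul_of_nonneg_left (add_le_add (add_le_add (sum_inv_density_le W 1)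
    (sum_inv_density_le W 2)) (sum_inv_density_le W 0)) hv.le
  rw [mul_pow]
  change _ ≤ 3 ^ n * v
  linarith

end AntiCorrelation

/-! ### From the game to relations on the answers to question 0 -/

namespace AntiCorrelation

theorem card_le_of_unsatisfiable {ι : Type*} [Fintype ι] [DecidableEq ι]
    (R : Fin 3 → Fin 2 → Fin 2 → Bool)
    (hR : ∀ t : Fin 3 → Fin 2, ∃ j, R j (t (j + 1)) (t (j + 2)) = false)
    (W : Finset (ι → Fin 3)) (s : Fin 3 → (ι → Fin 2) → ι → Fin 2)
    (hW : ∀ ω ∈ W, ∀ i, R (ω i) (s (ω i + 1) (view (ω i + 1) ω) i)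
      (s (ω i + 2) (view (ω i + 2) ω) i)) :
    (W.card : ℝ) ≤ (3 * (767 / 768)) ^ Fintype.card ι := by
  rcases isDegenerate_or_anticorrelated R hR with ⟨p, hp⟩ | ⟨e, he⟩
  · exact (card_le_of_isDegenerate R p hp W s hW).trans
      (pow_le_pow_left₀ (by norm_num) (by norm_num) _)
  · refine card_le_of_anticorrelated W (fun j σ i => s j σ i + e j) fun ω hω i j k hjk hj hk => ?_
    have h := he _ _ _ (hW ω hω i)
    generalize ω i = p at *
    obtain ⟨rfl, rfl⟩ | ⟨rfl, rfl⟩ : (j = p + 1 ∧ k = p + 2) ∨ (j = p + 2 ∧ k = p + 1) := by omega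
    exacts [h, h.symm]

variable (G : MultiplayerGame 3 (fun _ => Fin 2) (fun _ => Fin 2))

/-- Whether the answers `x`, `y` of the players `j + 1`, `j + 2` can win, when `j` is asked `1`. -/
noncomputable def winnable (j : Fin 3) (x y : Fin 2) : Bool :=
  open Classical in decide (∃ a, G.V (fun k => mark k j)
    (fun k => if k = j then a else if k = j + 1 then x else y) = true)

theorem winnable_of_win {j : Fin 3} {t : Fin 3 → Fin 2} (h : G.V (fun k => mark k j) t = true) :
    winnable G j (t (j + 1)) (t (j + 2)) = true := by
  classical
  refine decide_eq_true ⟨t j, ?_⟩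
  convert h using 2
  funext k
  split_ifs with h1 h2
  · rw [h1]
  · rw [h2]
  · congr 1
    omega

theorem exists_win_of_winnable {j : Fin 3} {t : Fin 3 → Fin 2}
    (h : winnable G j (t (j + 1)) (t (j + 2)) = true) :
    ∃ a, G.V (fun k => mark k j) (fun k => if k = j then a else t k) = true := by
  classical
  obtain ⟨a, ha⟩ := of_decide_eq_true h
  refine ⟨a, ?_⟩
  convert ha using 2
  funext k
  split_ifs with h1 h2
  · rfl
  · rw [h2]
  · congr 1
    omega

variable {G}

theorem Q_eq_of_isUniformOn (hQ : G.IsUniformOn {![1, 0, 0], ![0, 1, 0], ![0, 0, 1]}) :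
    (∀ j, G.Q (fun k => mark k j) = 1 / 3) ∧ ∀ x, G.Q x ≠ 0 → ∃ j, x = fun k => mark k j := by
  have e0 : (![1, 0, 0] : Fin 3 → Fin 2) = fun k => mark k 0 := by decide
  have e1 : (![0, 1, 0] : Fin 3 → Fin 2) = fun k => mark k 1 := by decide
  have e2 : (![0, 0, 1] : Fin 3 → Fin 2) = fun k => mark k 2 := by decide
  constructor
  · intro j
    have hj : (fun k => mark k j) ∈ ({![1, 0, 0], ![0, 1, 0], ![0, 0, 1]} : Finset (Fin 3 → Fin 2)) := by
      revert j; decide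
    have hc : ({![1, 0, 0], ![0, 1, 0], ![0, 0, 1]} : Finset (Fin 3 → Fin 2)).card = 3 := by decide
    rw [hQ, if_pos hj, hc]
    norm_num
  · intro x hx
    rw [hQ] at hx
    have hx' : x ∈ ({![1, 0, 0], ![0, 1, 0], ![0, 0, 1]} : Finset (Fin 3 → Fin 2)) := by
      by_contra h
      exact hx (if_neg h)
    simp only [Finset.mem_insert, Finset.mem_singleton, e0, e1, e2] at hx'
    rcases hx' with h | h | h
    exacts [⟨0, h⟩, ⟨1, h⟩, ⟨2, h⟩]

/-- Otherwise answering `t k` to `0` and the witness of winnability to `1` would win with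
probability one: each player is asked `1` in only one question triple, so these witnesses never
conflict. -/
theorem exists_not_winnable (hQ : G.IsUniformOn {![1, 0, 0], ![0, 1, 0], ![0, 0, 1]})
    (hval : G.val < 1) (t : Fin 3 → Fin 2) :
    ∃ j, winnable G j (t (j + 1)) (t (j + 2)) = false := by
  by_contra! hc
  choose a ha using fun j => exists_win_of_winnable G (Bool.eq_true_of_not_eq_false (hc j))
  refine hval.not_ge ?_
  refine le_trans (le_of_eq ?_) (G.isGreatest_val.2 ⟨fun k q => if q = 1 then a k else t k, rfl⟩)
  rw [MultiplayerGame.winProb, ← G.Q_sum]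
  refine Finset.sum_congr rfl fun x _ => ?_
  by_cases hx : G.Q x = 0
  · simp [hx]
  obtain ⟨j, rfl⟩ := (Q_eq_of_isUniformOn hQ).2 x hx
  rw [if_pos]
  convert ha j using 2
  funext k
  by_cases h : k = j
  · simp [mark, h]
  · simp [mark, h, Ne.symm h]

/-- The map from `ω` to the three views is a bijection onto the support of the repeated question
distribution, which is uniform there; this turns probability into counting. -/
theorem winProb_repetition (hQ : G.IsUniformOn {![1, 0, 0], ![0, 1, 0], ![0, 0, 1]}) (n : ℕ)
    (s : Fin 3 → (Fin n → Fin 2) → Fin n → Fin 2) :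
    (G.repetition n).winProb s = ({ω : Fin n → Fin 3 | ∀ i,
      G.V (fun k => mark k (ω i)) (fun k => s k (view k ω) i) = true} : Finset _).card / 3 ^ n := by
  have hinj : Function.Injective fun (ω : Fin n → Fin 3) (k : Fin 3) => view k ω := by
    intro ω ω' h
    funext i
    have h1 : mark (ω i) (ω i) = mark (ω i) (ω' i) := congrFun (congrFun h (ω i)) i
    unfold mark at h1
    by_contra h2
    simp [Ne.symm h2] at h1
  rw [MultiplayerGame.winProb]
  rw [← Fintype.sum_of_injective _ hinj (fun ω => if ∀ i,
    G.V (fun k => mark k (ω i)) (fun k => s k (view k ω) i) = true then (1 / 3 : ℝ) ^ n else 0)]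
  · rw [← Finset.sum_filter, Finset.sum_const, nsmul_eq_mul, one_div, inv_pow, div_eq_mul_inv]
  · intro x hx
    have : (G.repetition n).Q x = 0 := by
      by_contra h
      have h' : ∀ i ∈ Finset.univ, G.Q (fun k => x k i) ≠ 0 := Finset.prod_ne_zero_iff.1 h
      choose ω hω using fun i => (Q_eq_of_isUniformOn hQ).2 _ (h' i (Finset.mem_univ i))
      exact hx ⟨ω, funext fun k => funext fun i => (congrFun (hω i) k).symm⟩
    simp [this]
  · intro ω
    have : (G.repetition n).Q (fun k => view k ω) = (1 / 3) ^ n := by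
      change ∏ i, G.Q (fun k => mark k (ω i)) = _
      simp [(Q_eq_of_isUniformOn hQ).1]
    rw [this]
    refine if_congr ?_ rfl rfl
    exact decide_eq_true_iff.symm

end AntiCorrelation

open AntiCorrelation in
theorem mainTheorem5
    (G : MultiplayerGame 3 (fun _ => Fin 2) (fun _ => Fin 2))
    (hQ : G.IsUniformOn {![1, 0, 0], ![0, 1, 0], ![0, 0, 1]})
    (hval : G.val < 1) :
    ∃ c : ℝ, 0 < c ∧ ∀ n : ℕ, 1 ≤ n → (G.repetition n).val ≤ (2 : ℝ) ^ (-(c * (n : ℝ))) := by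
  refine ⟨-Real.logb 2 (767 / 768), ?_, fun n _ => ?_⟩
  · exact neg_pos.2 (Real.logb_neg (by norm_num) (by norm_num) (by norm_num))
  rw [neg_mul, neg_neg, Real.rpow_mul (by norm_num),
    Real.rpow_logb (by norm_num) (by norm_num) (by norm_num), Real.rpow_natCast]
  refine ciSup_le fun s => ?_
  rw [winProb_repetition hQ n s, div_le_iff₀ (by positivity), ← mul_pow, mul_comm]
  refine (card_le_of_unsatisfiable (winnable G) (exists_not_winnable hQ hval) _ s
    fun ω hω i => ?_).trans_eq (by rw [Fintype.card_fin])
  exact winnable_of_win G (t := fun k => s k (view k ω) i) ((Finset.mem_filter.1 hω).2 i)
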